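/- For integers $k,m\ge 1$ let $\mathcal S^k$ be the real vector space of symmetric $k\times k$ real matrices with scalar product $\langle A,B\rangle=\sum_{i,j}a_{ij}b_{ij}$, let $\mathcal S^k_+\subseteq\mathcal S^k$ be the cone of positive semidefinite matrices, and let $(\mathcal S^k_+)^m\subseteq(\mathcal S^k)^m$ be its $m$-fold product. A subset $S$ of a real vector space $V$ has an $(\mathcal S^k_+)^m$-lift if $S=\pi\big((\mathcal S^k_+)^m\cap H\big)$ for some affine subspace $H$ of $(\mathcal S^k)^m$ and some linear map $\pi:(\mathcal S^k)^m\to V$. The semidefinite extension degree $\operatorname{sxdeg}(S)\in\{1,2,\dots\}\cup\{\infty\}$ is the smallest $r\ge1$ such that $S$ has an $(\mathcal S^r_+)^m$-lift for some finite $m\ge1$, and $\operatorname{sxdeg}(S)=\infty$ if there is no such $r$. Let $$\operatorname{CP}_k=\{A\in\mathcal S^k : x^\top A x\ge 0\ \text{for all } x\in\mathbb R^k_{\ge 0}\}$$ be the cone of copositive matrices and let $$\operatorname{CP}_k^*=\{B\in\mathcal S^k : \langle A,B\rangle\ge 0\ \text{for all } A\in\operatorname{CP}_k\}$$ be its dual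 cone, the cone of completely positive matrices. Then, for every integer $k\ge1$, $$\operatorname{sxdeg}(\operatorname{CP}_k)=\operatorname{sxdeg}(\operatorname{CP}_k^*)\ge k$$ (where the common value may be $\infty$), and if $k\le 4$, then $$\operatorname{sxdeg}(\operatorname{CP}_k)=\operatorname{sxdeg}(\operatorname{CP}_k^*)=k.$$ -/

import Mathlib

open scoped Matrix

/-- The real vector space of symmetric real `k × k` matrices. -/
def SymMat (k : ℕ) : Submodule ℝ (Matrix (Fin k) (Fin k) ℝ) where
  carrier := {A | A.IsSymm}
  add_mem' hA hB := hA.add hB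
  zero_mem' := Matrix.isSymm_zero
  smul_mem' c _ hA := hA.smul c

/-- The scalar product `⟨A, B⟩ = ∑ i j, a i j * b i j` on symmetric matrices. -/
def symInner {k : ℕ} (A B : SymMat k) : ℝ :=
  ∑ i, ∑ j, A.1 i j * B.1 i j

/-- The conic dual of a set of symmetric matrices, taken inside the space of symmetric matrices. -/
def conicDual {k : ℕ} (X : Set (SymMat k)) : Set (SymMat k) :=
  {B | ∀ A ∈ X, 0 ≤ symInner A B}

/-- The cone of positive semidefinite matrices in the space of symmetric `k × k` matrices. -/
def psdCone (k : ℕ) : Set (SymMat k) :=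
  {A | A.1.PosSemidef}

/-- The `m`-fold product of the cone of positive semidefinite `k × k` matrices. -/
def psdConePow (k m : ℕ) : Set (Fin m → SymMat k) :=
  {A | ∀ i, A i ∈ psdCone k}

/-- `S` has a `K`-lift: `S` is the image under a linear map of the intersection of `K` with an
affine subspace of the space containing `K`. -/
def HasConeLift {E V : Type*} [AddCommGroup E] [Module ℝ E] [AddCommGroup V] [Module ℝ V]
    (K : Set E) (S : Set V) : Prop :=
  ∃ (H : AffineSubspace ℝ E) (π : E →ₗ[ℝ] V), S = π '' (K ∩ (H : Set E))

/-- The semidefinite extension degree of `S`: the smallest `k ≥ 1` such that, for some finite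
`m ≥ 1`, the set `S` has a lift to the `m`-fold product of the cone of positive semidefinite
`k × k` matrices. It is `⊤` if there is no such `k` (the infimum of the empty set in `ℕ∞`). -/
noncomputable def sxdeg {V : Type*} [AddCommGroup V] [Module ℝ V] (S : Set V) : ℕ∞ :=
  sInf {d : ℕ∞ | ∃ k : ℕ, d = k ∧ 1 ≤ k ∧ ∃ m : ℕ, 1 ≤ m ∧ HasConeLift (psdConePow k m) S}

/-- The cone of copositive `k × k` matrices. -/
def copositiveCone (k : ℕ) : Set (SymMat k) :=
  {A | ∀ x : Fin k → ℝ, (∀ i, 0 ≤ x i) → 0 ≤ x ⬝ᵥ (A.1 *ᵥ x)}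

/-- The cone of completely positive `k × k` matrices: the conic dual of the copositive cone. -/
def completelyPositiveCone (k : ℕ) : Set (SymMat k) :=
  conicDual (copositiveCone k)

/-!
The equality of the two degrees is conic duality. If `C = π (K ∩ H)` with `K` a product of positive
semidefinite cones of size `r`, then facial reduction, done by a congruence and hence without
changing `r`, lets `H` contain the tuple of identity matrices (`exists_lift_through_one`). Slater's
condition now holds, so an element `B` of the dual cone is certified by an element of `K` and a
nonnegative constant (`exists_dual_certificate`), and this description of `conicDual C` is again a
lift to blocks of size `r` (`HasConeLift.conicDual`). The copositive cone is the dual of its dual,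
since the matrices `x xᵀ` with `x ≥ 0` are completely positive.

For the lower bound, the same certificates factor the pairing between squares of linear forms and
matrices `x xᵀ`, with `x` on the moment curve, through positive semidefinite `r × r` blocks. For
each set of fewer than `k` points of the curve some linear form vanishes at exactly these points.
Hence the column spaces of the certificates are such that no point's spaces lie, in all blocks,
in the span of those of fewer than `k` other points; passing to generic points, one block produces
a chain of subspaces of `ℝ ^ r` of length `k` (`le_finrank_of_not_le_iSup`).

For `k ≤ 4` the completely positive matrices are the doubly nonnegative ones
(`completelyPositiveCone_eq`), which visibly lift to blocks of size `k`. By the Krein-Milman theorem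
one only has to pair copositive matrices with extreme doubly nonnegative matrices `B`. The range of
`B` contains a vector `w ≠ 0` without two nonzero entries at a zero of `B`, because either the
kernel of `B` is at most a line or its rank is at most two (`exists_range_vector`); perturbing `B`
along `w wᵀ` shows that an extreme `B` is a multiple of `w wᵀ`.
-/

/-! ### The trace form and rank one matrices -/

lemma symInner_comm {k : ℕ} (A B : SymMat k) : symInner A B = symInner B A := by
  simp only [symInner, mul_comm]

/-- The trace form on symmetric matrices as a bilinear map. -/
def symForm (k : ℕ) : SymMat k →ₗ[ℝ] SymMat k →ₗ[ℝ] ℝ :=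
  LinearMap.mk₂ ℝ symInner
    (fun A B C => by simp [symInner, add_mul, Finset.sum_add_distrib])
    (fun c A B => by simp [symInner, mul_assoc, Finset.mul_sum])
    (fun A B C => by simp [symInner, mul_add, Finset.sum_add_distrib])
    (fun c A B => by simp [symInner, mul_left_comm, Finset.mul_sum])

@[simp] lemma symForm_apply {k : ℕ} (A B : SymMat k) : symForm k A B = symInner A B := rfl

/-- The rank one matrix `x xᵀ`. -/
def symOuter {k : ℕ} (x : Fin k → ℝ) : SymMat k :=
  ⟨Matrix.vecMulVec x x, by
    ext i j
    simp [Matrix.vecMulVec_apply, mul_comm]⟩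

@[simp] lemma symOuter_apply {k : ℕ} (x : Fin k → ℝ) (i j : Fin k) :
    (symOuter x).1 i j = x i * x j := rfl

lemma symInner_symOuter {k : ℕ} (A : SymMat k) (x : Fin k → ℝ) :
    symInner A (symOuter x) = x ⬝ᵥ (A.1 *ᵥ x) := by
  simp only [symInner, symOuter_apply, dotProduct, Matrix.mulVec, Finset.mul_sum]
  exact Finset.sum_congr rfl fun i _ => Finset.sum_congr rfl fun j _ => by ring

lemma mem_psdCone_iff {k : ℕ} (A : SymMat k) :
    A ∈ psdCone k ↔ ∀ x : Fin k → ℝ, 0 ≤ x ⬝ᵥ (A.1 *ᵥ x) := by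
  have hA : A.1.IsHermitian := by
    rw [Matrix.IsHermitian, Matrix.conjTranspose_eq_transpose_of_trivial]
    exact A.2
  exact ⟨fun h x => by simpa using Matrix.PosSemidef.dotProduct_mulVec_nonneg h x,
    fun h => Matrix.PosSemidef.of_dotProduct_mulVec_nonneg hA (by simpa using h)⟩

lemma symOuter_mem_psdCone {k : ℕ} (x : Fin k → ℝ) : symOuter x ∈ psdCone k := by
  rw [mem_psdCone_iff]
  intro y
  have : y ⬝ᵥ ((symOuter x).1 *ᵥ y) = (x ⬝ᵥ y) ^ 2 := by
    change y ⬝ᵥ (Matrix.vecMulVec x x *ᵥ y) = _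
    rw [Matrix.vecMulVec_mulVec]
    simp [dotProduct_comm y x, sq]
  rw [this]
  positivity

lemma symInner_eq_trace {k : ℕ} (A B : SymMat k) : symInner A B = (A.1 * B.1).trace := by
  simp only [symInner, Matrix.trace, Matrix.diag, Matrix.mul_apply]
  exact Finset.sum_congr rfl fun i _ => Finset.sum_congr rfl fun j _ => by
    rw [← (show B.1ᵀ = B.1 from B.2), Matrix.transpose_apply, show B.1ᵀ = B.1 from B.2]

/-- A positive semidefinite matrix is a sum of rank one matrices. -/
lemma exists_eq_sum_symOuter {k : ℕ} {B : SymMat k} (hB : B ∈ psdCone k) :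
    ∃ (n : ℕ) (v : Fin n → Fin k → ℝ), B = ∑ l, symOuter (v l) := by
  obtain ⟨n, v, hv⟩ := Matrix.posSemidef_iff_eq_sum_vecMulVec.1 hB
  refine ⟨n, v, Subtype.ext ?_⟩
  rw [hv, AddSubmonoidClass.coe_finsetSum]
  simp [symOuter]

lemma symInner_nonneg {k : ℕ} {A B : SymMat k} (hA : A ∈ psdCone k) (hB : B ∈ psdCone k) :
    0 ≤ symInner A B := by
  obtain ⟨n, v, rfl⟩ := exists_eq_sum_symOuter hB
  rw [← symForm_apply, map_sum]
  refine Finset.sum_nonneg fun l _ => ?_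
  rw [symForm_apply, symInner_symOuter]
  exact (mem_psdCone_iff A).1 hA _

lemma mul_eq_zero_of_symInner_eq_zero {k : ℕ} {A B : SymMat k} (hA : A ∈ psdCone k)
    (hB : B ∈ psdCone k) (h : symInner A B = 0) : A.1 * B.1 = 0 := by
  obtain ⟨n, v, rfl⟩ := exists_eq_sum_symOuter hB
  rw [← symForm_apply, map_sum, Finset.sum_eq_zero_iff_of_nonneg] at h
  · rw [AddSubmonoidClass.coe_finsetSum, Finset.mul_sum]
    refine Finset.sum_eq_zero fun l hl => ?_
    have := h l hl
    rw [symForm_apply, symInner_symOuter] at this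
    have h0 : A.1 *ᵥ v l = 0 := (Matrix.PosSemidef.dotProduct_mulVec_zero_iff hA (v l)).1 (by simpa)
    change A.1 * Matrix.vecMulVec _ _ = 0
    rw [Matrix.mul_vecMulVec, h0, Matrix.zero_vecMulVec]
  · intro l _
    exact symInner_nonneg hA (symOuter_mem_psdCone _)

/-! ### Facial reduction -/

/-- A symmetric matrix has a commuting symmetric generalized inverse: invert the nonzero
eigenvalues. -/
lemma exists_pseudoinverse {k : ℕ} {A : Matrix (Fin k) (Fin k) ℝ} (hA : A.IsSymm) :
    ∃ G : Matrix (Fin k) (Fin k) ℝ, G.IsSymm ∧ A * G = G * A ∧ A * G * A = A := by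
  have hA' : A.IsHermitian := by
    rwa [Matrix.IsHermitian, Matrix.conjTranspose_eq_transpose_of_trivial]
  set φ := Unitary.conjStarAlgAut ℝ (Matrix (Fin k) (Fin k) ℝ) hA'.eigenvectorUnitary
  set D : Matrix (Fin k) (Fin k) ℝ := Matrix.diagonal hA'.eigenvalues
  set D' : Matrix (Fin k) (Fin k) ℝ := Matrix.diagonal fun i => (hA'.eigenvalues i)⁻¹
  have h : A = φ D := hA'.spectral_theorem
  refine ⟨φ D', ?_, ?_, ?_⟩
  · rw [Matrix.IsSymm, ← Matrix.conjTranspose_eq_transpose_of_trivial,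
      ← Matrix.star_eq_conjTranspose, ← map_star]
    simp [D', Matrix.star_eq_conjTranspose]
  · rw [h, ← map_mul, ← map_mul]
    simp [D, D', mul_comm]
  · rw [h, ← map_mul, ← map_mul]
    congr 1
    simp only [D, D', Matrix.diagonal_mul_diagonal]
    congr 1
    ext i
    exact mul_inv_mul_cancel _

/-- The congruence `X ↦ M X Mᵀ` on symmetric matrices. -/
def symCongr {k : ℕ} (M : Matrix (Fin k) (Fin k) ℝ) : SymMat k →ₗ[ℝ] SymMat k where
  toFun X := ⟨M * X.1 * Mᵀ, by
    change (M * X.1 * Mᵀ)ᵀ = _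
    rw [Matrix.transpose_mul, Matrix.transpose_mul, Matrix.transpose_transpose,
      show X.1ᵀ = X.1 from X.2, Matrix.mul_assoc]⟩
  map_add' X Y := Subtype.ext (by simp [mul_add, add_mul])
  map_smul' c X := Subtype.ext (by simp)

lemma symCongr_mem_psdCone {k : ℕ} (M : Matrix (Fin k) (Fin k) ℝ) {X : SymMat k}
    (hX : X ∈ psdCone k) : symCongr M X ∈ psdCone k := by
  have := Matrix.PosSemidef.mul_mul_conjTranspose_same hX M
  rwa [Matrix.conjTranspose_eq_transpose_of_trivial] at this

/-- The identity matrix as a symmetric matrix. -/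
def symOne (k : ℕ) : SymMat k := ⟨1, Matrix.isSymm_one⟩

lemma symOne_mem_psdCone (k : ℕ) : symOne k ∈ psdCone k := Matrix.PosSemidef.one

/-- For positive semidefinite `A`, congruence by `√A` maps the identity to `A` and maps the
positive semidefinite cone onto its minimal face containing `A`. -/
lemma exists_symCongr_onto_face {k : ℕ} {A : SymMat k} (hA : A ∈ psdCone k) :
    ∃ M : Matrix (Fin k) (Fin k) ℝ, symCongr M (symOne k) = A ∧
      ∀ X ∈ psdCone k, (∀ v, A.1 *ᵥ v = 0 → X.1 *ᵥ v = 0) →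
        ∃ Y ∈ psdCone k, symCongr M Y = X := by
  obtain ⟨R, hR, hRA⟩ : ∃ R : Matrix (Fin k) (Fin k) ℝ, R.IsSymm ∧ R * R = A.1 := by
    open scoped MatrixOrder in
    have h0 : (0 : Matrix (Fin k) (Fin k) ℝ) ≤ A.1 := Matrix.nonneg_iff_posSemidef.2 hA
    refine ⟨CFC.sqrt A.1, ?_, CFC.sqrt_mul_sqrt_self A.1 h0⟩
    have h1 := (Matrix.nonneg_iff_posSemidef.1 (CFC.sqrt_nonneg A.1)).1
    rwa [Matrix.IsHermitian, Matrix.conjTranspose_eq_transpose_of_trivial] at h1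
  obtain ⟨G, hG, hcomm, hRG⟩ := exists_pseudoinverse hR
  refine ⟨R, Subtype.ext ?_, fun X hX hker => ⟨symCongr G X, symCongr_mem_psdCone G hX,
    Subtype.ext ?_⟩⟩
  · change R * 1 * Rᵀ = A.1
    rw [mul_one, show Rᵀ = R from hR, hRA]
  · change R * (G * X.1 * Gᵀ) * Rᵀ = X.1
    rw [show Rᵀ = R from hR, show Gᵀ = G from hG]
    have h1 : A.1 * (1 - R * G) = 0 := by
      rw [mul_sub, mul_one, ← hRA, mul_assoc R R, hcomm, ← mul_assoc R G, hRG, sub_self]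
    have h2 : X.1 * (1 - R * G) = 0 := by
      ext i j
      have h3 : A.1 *ᵥ ((1 - R * G).col j) = 0 := by
        ext i
        exact congrFun (congrFun h1 i) j
      exact congrFun (hker _ h3) i
    have h3 : X.1 * (R * G) = X.1 := by
      rw [mul_sub, mul_one, sub_eq_zero] at h2
      exact h2.symm
    have h4 : R * G * X.1 = X.1 := by
      have := congrArg Matrix.transpose h3
      rwa [Matrix.transpose_mul, Matrix.transpose_mul, show Rᵀ = R from hR,
        show Gᵀ = G from hG, show X.1ᵀ = X.1 from X.2, ← hcomm] at this
    calc R * (G * X.1 * G) * R = R * G * X.1 * (G * R) := by simp only [mul_assoc]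
      _ = X.1 := by rw [h4, ← hcomm, h3]

/-- Some `A` in the convex set `K ∩ H` has blockwise smallest kernels: a tuple minimizing the
total kernel dimension works, since the kernel of a midpoint is the intersection of the kernels. -/
lemma exists_minimal_kernel {r m : ℕ} (H : AffineSubspace ℝ (Fin m → SymMat r))
    (hne : (psdConePow r m ∩ (H : Set (Fin m → SymMat r))).Nonempty) :
    ∃ A ∈ psdConePow r m ∩ (H : Set (Fin m → SymMat r)),
      ∀ X ∈ psdConePow r m ∩ (H : Set (Fin m → SymMat r)),
        ∀ j v, (A j).1 *ᵥ v = 0 → (X j).1 *ᵥ v = 0 := by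
  let f : (Fin m → SymMat r) → ℕ := fun A =>
    ∑ j, Module.finrank ℝ (LinearMap.ker (Matrix.mulVecLin (A j).1))
  obtain ⟨A, hA, hmin⟩ : ∃ A ∈ psdConePow r m ∩ (H : Set (Fin m → SymMat r)),
      ∀ X ∈ psdConePow r m ∩ (H : Set (Fin m → SymMat r)), f A ≤ f X := by
    obtain ⟨_, ⟨A, hA, rfl⟩, hmin⟩ := wellFounded_lt.has_min _ (hne.image f)
    exact ⟨A, hA, fun X hX => not_lt.1 (hmin _ ⟨X, hX, rfl⟩)⟩
  refine ⟨A, hA, fun X hX j v hv => ?_⟩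
  let Y : Fin m → SymMat r := (1 / 2 : ℝ) • A + (1 / 2 : ℝ) • X
  have hYK : Y ∈ psdConePow r m := by
    intro i
    have := ((hA.1 i).smul (by norm_num : (0 : ℝ) ≤ 1 / 2)).add
      ((hX.1 i).smul (by norm_num : (0 : ℝ) ≤ 1 / 2))
    exact this
  have hYH : Y ∈ (H : Set (Fin m → SymMat r)) :=
    H.convex hA.2 hX.2 (by norm_num) (by norm_num) (by norm_num)
  have hker : ∀ i w, (Y i).1 *ᵥ w = 0 → (A i).1 *ᵥ w = 0 ∧ (X i).1 *ᵥ w = 0 := by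
    intro i w hw
    have h1 := (mem_psdCone_iff _).1 (hA.1 i) w
    have h2 := (mem_psdCone_iff _).1 (hX.1 i) w
    have h3 : w ⬝ᵥ ((Y i).1 *ᵥ w) =
        (1 / 2) * (w ⬝ᵥ ((A i).1 *ᵥ w)) + (1 / 2) * (w ⬝ᵥ ((X i).1 *ᵥ w)) := by
      simp [Y, Matrix.add_mulVec, Matrix.smul_mulVec]
    rw [hw, dotProduct_zero] at h3
    exact ⟨((hA.1 i).dotProduct_mulVec_zero_iff w).1 (by simp; linarith),
      ((hX.1 i).dotProduct_mulVec_zero_iff w).1 (by simp; linarith)⟩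
  have hle : ∀ i, LinearMap.ker (Matrix.mulVecLin (Y i).1) ≤
      LinearMap.ker (Matrix.mulVecLin (A i).1) := fun i w hw => (hker i w hw).1
  have heq : f Y = f A :=
    le_antisymm (Finset.sum_le_sum fun i _ => Submodule.finrank_mono (hle i))
      (hmin Y ⟨hYK, hYH⟩)
  have hj := (Finset.sum_eq_sum_iff_of_le
    (fun i _ => Submodule.finrank_mono (hle i))).1 heq j (Finset.mem_univ j)
  have hkk := Submodule.eq_of_le_of_finrank_eq (hle j) hj
  have : v ∈ LinearMap.ker (Matrix.mulVecLin (Y j).1) := by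
    rw [hkk]
    exact hv
  exact (hker j v this).2

/-- Facial reduction: a nonempty set with a lift has a lift of the same type whose affine
subspace contains the tuple of identity matrices, an interior point of the cone. -/
lemma exists_lift_through_one {r m : ℕ} {V : Type*} [AddCommGroup V] [Module ℝ V] {S : Set V}
    (hS : S.Nonempty) (h : HasConeLift (psdConePow r m) S) :
    ∃ (H : AffineSubspace ℝ (Fin m → SymMat r)) (π : (Fin m → SymMat r) →ₗ[ℝ] V),
      (fun _ => symOne r) ∈ H ∧ S = π '' (psdConePow r m ∩ (H : Set (Fin m → SymMat r))) := by
  obtain ⟨H, π, rfl⟩ := h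
  obtain ⟨A, hA, hmin⟩ := exists_minimal_kernel H (Set.image_nonempty.1 hS)
  choose M hM1 hM using fun j => exists_symCongr_onto_face (hA.1 j)
  let φ : (Fin m → SymMat r) →ₗ[ℝ] (Fin m → SymMat r) :=
    LinearMap.pi fun j => symCongr (M j) ∘ₗ LinearMap.proj j
  refine ⟨H.comap φ.toAffineMap, π ∘ₗ φ, ?_, Set.Subset.antisymm ?_ ?_⟩
  · have : φ (fun _ => symOne r) = A := funext fun j => hM1 j
    rw [AffineSubspace.mem_comap]
    change φ _ ∈ H
    rw [this]
    exact hA.2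
  · rintro _ ⟨X, hX, rfl⟩
    choose Y hY hYX using fun j => hM j (X j) (hX.1 j) (hmin X hX j)
    have hφ : φ Y = X := funext fun j => hYX j
    exact ⟨Y, ⟨hY, show φ Y ∈ H from hφ ▸ hX.2⟩, by simp [hφ]⟩
  · rintro _ ⟨Y, hY, rfl⟩
    exact ⟨φ Y, ⟨fun j => symCongr_mem_psdCone _ (hY.1 j), hY.2⟩, rfl⟩

/-! ### Duality of lifts -/

/-- Adding a large multiple of the identity makes a symmetric matrix positive semidefinite. -/
lemma exists_smul_symOne_add_mem_psdCone {k : ℕ} (Y : SymMat k) :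
    ∃ c : ℝ, ∀ t : ℝ, c ≤ t → t • symOne k + Y ∈ psdCone k := by
  refine ⟨∑ i, ∑ j, |Y.1 i j|, fun t ht => ?_⟩
  rw [mem_psdCone_iff]
  intro v
  have h1 : v ⬝ᵥ ((t • symOne k + Y).1 *ᵥ v) = t * (v ⬝ᵥ v) + v ⬝ᵥ (Y.1 *ᵥ v) := by
    simp [symOne, Matrix.add_mulVec, Matrix.smul_mulVec]
  have hv : ∀ i, v i ^ 2 ≤ v ⬝ᵥ v := fun i => by
    rw [sq]
    exact Finset.single_le_sum (f := fun i => v i * v i) (fun i _ => mul_self_nonneg _)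
      (Finset.mem_univ i)
  have h0 : 0 ≤ v ⬝ᵥ v := Finset.sum_nonneg fun i _ => mul_self_nonneg _
  have h2 : -((∑ i, ∑ j, |Y.1 i j|) * (v ⬝ᵥ v)) ≤ v ⬝ᵥ (Y.1 *ᵥ v) := by
    rw [← symInner_symOuter, symInner, Finset.sum_mul, ← Finset.sum_neg_distrib]
    refine Finset.sum_le_sum fun i _ => ?_
    rw [Finset.sum_mul, ← Finset.sum_neg_distrib]
    refine Finset.sum_le_sum fun j _ => ?_
    rw [symOuter_apply]
    have h3 : |v i * v j| ≤ v ⬝ᵥ v :=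
      abs_le.2 ⟨by nlinarith [hv i, hv j, sq_nonneg (v i + v j)],
        by nlinarith [hv i, hv j, sq_nonneg (v i - v j)]⟩
    have h4 : |Y.1 i j * (v i * v j)| ≤ |Y.1 i j| * (v ⬝ᵥ v) := by
      rw [abs_mul]
      exact mul_le_mul_of_nonneg_left h3 (abs_nonneg _)
    exact (abs_le.1 h4).1
  rw [h1]
  nlinarith [mul_le_mul_of_nonneg_right ht h0]

/-- Every linear functional on symmetric matrices is represented by the trace form. -/
lemma exists_symInner_eq {k : ℕ} (g : SymMat k →ₗ[ℝ] ℝ) :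
    ∃ s : SymMat k, ∀ x, g x = symInner s x := by
  have hinj : Function.Injective (symForm k) := by
    rw [← LinearMap.ker_eq_bot, LinearMap.ker_eq_bot']
    intro A hA
    have h : symInner A A = 0 := by rw [← symForm_apply, hA, LinearMap.zero_apply]
    have h1 := (Finset.sum_eq_zero_iff_of_nonneg fun i _ =>
      Finset.sum_nonneg fun j _ => mul_self_nonneg (A.1 i j)).1 h
    ext i j
    have h2 := (Finset.sum_eq_zero_iff_of_nonneg fun j _ => mul_self_nonneg (A.1 i j)).1
      (h1 i (Finset.mem_univ i)) j (Finset.mem_univ j)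
    exact mul_self_eq_zero.1 h2
  obtain ⟨s, hs⟩ := (LinearMap.injective_iff_surjective_of_finrank_eq_finrank
    (Subspace.dual_finrank_eq (K := ℝ) (V := SymMat k)).symm).1 hinj g
  exact ⟨s, fun x => by rw [← hs, symForm_apply]⟩

/-- A functional that is nonnegative on the product of positive semidefinite cones is the inner
product with an element of that product: the cone is self-dual. -/
lemma exists_psdConePow_repr {r m : ℕ} (g : (Fin m → SymMat r) →ₗ[ℝ] ℝ)
    (hg : ∀ x ∈ psdConePow r m, 0 ≤ g x) :
    ∃ s ∈ psdConePow r m, ∀ x, g x = ∑ j, symInner (s j) (x j) := by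
  choose s hs using fun j =>
    exists_symInner_eq (g ∘ₗ LinearMap.single ℝ (fun _ : Fin m => SymMat r) j)
  refine ⟨s, fun j => (mem_psdCone_iff _).2 fun v => ?_, fun x => ?_⟩
  · rw [← symInner_symOuter, ← hs]
    refine hg _ fun i => ?_
    by_cases hij : i = j
    · subst hij
      simpa using symOuter_mem_psdCone v
    · simp only [LinearMap.coe_single, Pi.single_eq_of_ne hij]
      exact Matrix.PosSemidef.zero
  · calc g x = g (∑ j, Pi.single j (x j)) := by rw [Finset.univ_sum_single]
      _ = _ := by
        rw [map_sum]
        exact Finset.sum_congr rfl fun j _ => by rw [← hs]; rfl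

/-- Strong conic duality under Slater's condition: an affine subspace through an interior point of
the cone has every linear inequality on `K ∩ H` certified by an element of the dual cone, with a
nonnegative constant. The certificate comes from the M. Riesz extension theorem on the cone
`K × ℝ≥0`, applied to the linear span of `H × {1}`. -/
lemma exists_dual_certificate {r m : ℕ} {H : AffineSubspace ℝ (Fin m → SymMat r)}
    (h1 : (fun _ => symOne r) ∈ H) (f : (Fin m → SymMat r) →ₗ[ℝ] ℝ)
    (hf : ∀ x ∈ psdConePow r m, x ∈ H → 0 ≤ f x) :
    ∃ s ∈ psdConePow r m, ∃ t : ℝ, 0 ≤ t ∧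
      ∀ x ∈ H, f x = (∑ j, symInner (s j) (x j)) + t := by
  set a : Fin m → SymMat r := fun _ => symOne r
  let M : Submodule ℝ ((Fin m → SymMat r) × ℝ) :=
    H.direction.comap (LinearMap.fst ℝ _ _ - (LinearMap.snd ℝ _ _).smulRight a)
  have hM : ∀ x τ, (x, τ) ∈ M ↔ x - τ • a ∈ H.direction := fun x τ => Iff.rfl
  let K : PointedCone ℝ ((Fin m → SymMat r) × ℝ) :=
    { carrier := {p | p.1 ∈ psdConePow r m ∧ 0 ≤ p.2}
      add_mem' := fun {p q} hp hq => ⟨fun j => (hp.1 j).add (hq.1 j), add_nonneg hp.2 hq.2⟩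
      zero_mem' := ⟨fun _ => Matrix.PosSemidef.zero, le_rfl⟩
      smul_mem' := fun c p hp => ⟨fun j => (hp.1 j).smul c.2, mul_nonneg c.2 hp.2⟩ }
  have hKs : ∀ (c : ℝ), 0 ≤ c → ∀ x ∈ psdConePow r m, c • x ∈ psdConePow r m :=
    fun c hc x hx j => (hx j).smul hc
  have hKa : ∀ x ∈ psdConePow r m, ∀ y ∈ psdConePow r m, x + y ∈ psdConePow r m :=
    fun x hx y hy j => (hx j).add (hy j)
  have haK : a ∈ psdConePow r m := fun _ => symOne_mem_psdCone r
  obtain ⟨g, hgM, hgK⟩ := riesz_extension K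
    ⟨M, (f ∘ₗ LinearMap.fst ℝ (Fin m → SymMat r) ℝ).domRestrict M⟩ (by
      rintro ⟨⟨x, τ⟩, hx⟩ ⟨hxK, hτ⟩
      change 0 ≤ f x
      replace hx := (hM x τ).1 hx
      dsimp only at hxK hτ
      rcases hτ.eq_or_lt with rfl | hτ
      · -- `x` is a recession direction: `a + n • x` stays in `K ∩ H` for all `n`
        rw [zero_smul, sub_zero] at hx
        by_contra! hneg
        obtain ⟨n, hn⟩ := exists_nat_gt (f a / -f x)
        have h2 := hf (a + (n : ℝ) • x) (hKa _ haK _ (hKs _ n.cast_nonneg _ hxK)) (by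
          rw [add_comm]
          exact AffineSubspace.vadd_mem_of_mem_direction (H.direction.smul_mem _ hx) h1)
        rw [map_add, map_smul, smul_eq_mul] at h2
        rw [div_lt_iff₀ (by linarith)] at hn
        linarith
      · have h2 := hf (τ⁻¹ • x) (hKs _ (inv_nonneg.2 hτ.le) _ hxK) (by
          have h3 := AffineSubspace.vadd_mem_of_mem_direction
            (H.direction.smul_mem τ⁻¹ hx) h1
          rwa [smul_sub, smul_smul, inv_mul_cancel₀ hτ.ne', one_smul, vadd_eq_add,
            sub_add_cancel] at h3)
        rw [map_smul, smul_eq_mul] at h2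
        exact nonneg_of_mul_nonneg_right h2 (inv_pos.2 hτ)) (by
      rintro ⟨y, σ⟩
      choose c hc using fun j => exists_smul_symOne_add_mem_psdCone (y j)
      set τ : ℝ := |σ| + ∑ j, |c j|
      refine ⟨⟨(τ • a, τ), (hM _ _).2 (by rw [sub_self]; exact H.direction.zero_mem)⟩, ?_, ?_⟩
      · intro j
        refine hc j τ ?_
        have h2 : |c j| ≤ ∑ j, |c j| :=
          Finset.single_le_sum (f := fun j => |c j|) (fun _ _ => abs_nonneg _) (Finset.mem_univ j)
        linarith [le_abs_self (c j), abs_nonneg σ]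
      · have h2 : 0 ≤ ∑ j, |c j| := Finset.sum_nonneg fun _ _ => abs_nonneg _
        change 0 ≤ τ + σ
        linarith [neg_abs_le σ])
  obtain ⟨s, hs, hgs⟩ := exists_psdConePow_repr (g ∘ₗ LinearMap.inl ℝ _ ℝ) fun x hx =>
    hgK (x, 0) ⟨hx, le_rfl⟩
  refine ⟨s, hs, g (0, 1), hgK _ ⟨fun _ => Matrix.PosSemidef.zero, zero_le_one⟩, fun x hx => ?_⟩
  have hxM : (x, (1 : ℝ)) ∈ M := by
    rw [hM, one_smul]
    exact AffineSubspace.vsub_mem_direction hx h1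
  have h2 : g (x, 1) = f x := hgM ⟨_, hxM⟩
  rw [← h2, ← hgs, LinearMap.comp_apply, ← map_add]
  simp

/-- An extended formulation with positive semidefinite blocks, nonnegative scalar variables and
free variables gives a lift: a nonnegative scalar is the corner entry of a further block, and a
free variable is a difference of two of these. -/
lemma hasConeLift_of_extendedFormulation {r m : ℕ} (hr : 1 ≤ r) {ι : Type*} [Fintype ι]
    [Nonempty ι] {V : Type*} [AddCommGroup V] [Module ℝ V] [FiniteDimensional ℝ V]
    (W : Submodule ℝ ((Fin m → SymMat r) × (ι → ℝ) × V)) :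
    ∃ n, 1 ≤ n ∧ HasConeLift (psdConePow r n)
      {y | ∃ s ∈ psdConePow r m, ∃ t : ι → ℝ, (∀ i, 0 ≤ t i) ∧ (s, t, y) ∈ W} := by
  let o : Fin r := ⟨0, hr⟩
  let b := Module.finBasis ℝ V
  let d := Module.finrank ℝ V
  let J := Fin m ⊕ ι ⊕ Fin d ⊕ Fin d
  let e := Fintype.equivFin J
  let block : J → (Fin (Fintype.card J) → SymMat r) →ₗ[ℝ] SymMat r := fun j => LinearMap.proj (e j)
  let corner : SymMat r →ₗ[ℝ] ℝ :=
    LinearMap.proj o ∘ₗ LinearMap.proj o ∘ₗ (SymMat r).subtype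
  have hcorner : ∀ c : ℝ, corner (c • symOne r) = c := fun c => by
    rw [map_smul]
    change c • (1 : Matrix (Fin r) (Fin r) ℝ) o o = c
    simp
  let y : (Fin (Fintype.card J) → SymMat r) →ₗ[ℝ] V := ∑ l,
    (corner ∘ₗ block (.inr (.inr (.inl l))) - corner ∘ₗ block (.inr (.inr (.inr l)))).smulRight
      (b l)
  let Ψ : (Fin (Fintype.card J) → SymMat r) →ₗ[ℝ] ((Fin m → SymMat r) × (ι → ℝ) × V) :=
    (LinearMap.pi fun j => block (.inl j)).prod
      ((LinearMap.pi fun i => corner ∘ₗ block (.inr (.inl i))).prod y)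
  refine ⟨Fintype.card J, Fintype.card_pos, (W.comap Ψ).toAffineSubspace, y,
    Set.Subset.antisymm ?_ ?_⟩
  · rintro z ⟨s, hs, t, ht, hW⟩
    let c : J → SymMat r := Sum.elim s (Sum.elim (fun i => t i • symOne r)
      (Sum.elim (fun l => max (b.repr z l) 0 • symOne r)
        (fun l => max (-b.repr z l) 0 • symOne r)))
    have hbl : ∀ j, block j (c ∘ e.symm) = c j := fun j => by simp [block]
    have hy : y (c ∘ e.symm) = z := by
      simp only [y, LinearMap.sum_apply, LinearMap.smulRight_apply, LinearMap.sub_apply,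
        LinearMap.comp_apply, hbl, c, Sum.elim_inr, Sum.elim_inl, hcorner]
      conv_rhs => rw [← b.sum_repr z]
      refine Finset.sum_congr rfl fun l _ => ?_
      congr 1
      rcases le_total 0 (b.repr z l) with h | h
      · rw [max_eq_left h, max_eq_right (by linarith), sub_zero]
      · rw [max_eq_right h, max_eq_left (by linarith), zero_sub, neg_neg]
    have hΨ : Ψ (c ∘ e.symm) = (s, t, z) := by
      refine Prod.ext ?_ (Prod.ext ?_ hy)
      · exact funext fun j => hbl (.inl j)
      · refine funext fun i => ?_
        change corner (block (.inr (.inl i)) (c ∘ e.symm)) = t i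
        rw [hbl]
        exact hcorner _
    refine ⟨c ∘ e.symm, ⟨fun j => ?_, show Ψ _ ∈ W from hΨ ▸ hW⟩, hy⟩
    have hc : ∀ j, c j ∈ psdCone r := by
      rintro (j | i | l | l)
      · exact hs j
      · exact (symOne_mem_psdCone r).smul (ht i)
      · exact (symOne_mem_psdCone r).smul (le_max_right _ _)
      · exact (symOne_mem_psdCone r).smul (le_max_right _ _)
    exact hc _
  · rintro _ ⟨x, ⟨hxK, hxW⟩, rfl⟩
    exact ⟨_, fun j => hxK (e (.inl j)), _, fun i => (hxK (e (.inr (.inl i)))).diag_nonneg, hxW⟩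

/-- The dual of a nonempty set with a lift has a lift with blocks of the same size. -/
lemma HasConeLift.conicDual {k r m : ℕ} (hr : 1 ≤ r) {C : Set (SymMat k)} (hC : C.Nonempty)
    (h : HasConeLift (psdConePow r m) C) :
    ∃ n, 1 ≤ n ∧ HasConeLift (psdConePow r n) (conicDual C) := by
  obtain ⟨H, π, h1, rfl⟩ := exists_lift_through_one hC h
  let W : Submodule ℝ ((Fin m → SymMat r) × (Unit → ℝ) × SymMat k) :=
    ⨅ x : H, LinearMap.ker
      ((symForm k (π x) ∘ₗ LinearMap.snd ℝ (Unit → ℝ) (SymMat k) -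
          LinearMap.proj () ∘ₗ LinearMap.fst ℝ (Unit → ℝ) (SymMat k)) ∘ₗ LinearMap.snd ℝ _ _ -
        (∑ j, (symForm r).flip (x.1 j) ∘ₗ LinearMap.proj j) ∘ₗ LinearMap.fst ℝ _ _)
  have hW : ∀ s t B, (s, t, B) ∈ W ↔
      ∀ x ∈ H, symInner (π x) B = (∑ j, symInner (s j) (x j)) + t () := by
    intro s t B
    simp only [W, Submodule.mem_iInf, LinearMap.mem_ker, Subtype.forall]
    refine forall₂_congr fun x _ => ?_
    simp only [LinearMap.sub_apply, LinearMap.comp_apply, LinearMap.snd_apply,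
      LinearMap.fst_apply, LinearMap.sum_apply, LinearMap.flip_apply, symForm_apply,
      LinearMap.proj_apply]
    constructor <;> intro h <;> linarith
  obtain ⟨n, hn, hlift⟩ := hasConeLift_of_extendedFormulation hr W
  refine ⟨n, hn, ?_⟩
  convert hlift using 1
  ext B
  constructor
  · intro hB
    obtain ⟨s, hs, t, ht, hst⟩ := exists_dual_certificate h1 ((symForm k).flip B ∘ₗ π)
      fun x hx hxH => hB _ ⟨x, ⟨hx, hxH⟩, rfl⟩
    exact ⟨s, hs, fun _ => t, fun _ => ht, (hW _ _ _).2 hst⟩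
  · rintro ⟨s, hs, t, ht, hst⟩ _ ⟨x, ⟨hx, hxH⟩, rfl⟩
    rw [(hW _ _ _).1 hst x hxH]
    exact add_nonneg (Finset.sum_nonneg fun j _ => symInner_nonneg (hs j) (hx j)) (ht ())

lemma sxdeg_conicDual_le {k : ℕ} {C : Set (SymMat k)} (hC : C.Nonempty) :
    sxdeg (conicDual C) ≤ sxdeg C := by
  refine sInf_le_sInf ?_
  rintro d ⟨r, rfl, hr, m, -, h⟩
  exact ⟨r, rfl, hr, h.conicDual hr hC⟩

/-! ### Duality of the copositive and completely positive cones -/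

lemma symOuter_mem_completelyPositiveCone {k : ℕ} {x : Fin k → ℝ} (hx : ∀ i, 0 ≤ x i) :
    symOuter x ∈ completelyPositiveCone k := fun A hA => by
  rw [symInner_symOuter]
  exact hA x hx

lemma conicDual_completelyPositiveCone (k : ℕ) :
    conicDual (completelyPositiveCone k) = copositiveCone k := by
  ext A
  constructor
  · intro hA x hx
    rw [← symInner_symOuter, symInner_comm]
    exact hA _ (symOuter_mem_completelyPositiveCone hx)
  · intro hA B hB
    rw [symInner_comm]
    exact hB A hA

lemma psdCone_subset_copositiveCone (k : ℕ) : psdCone k ⊆ copositiveCone k :=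
  fun A hA x _ => (mem_psdCone_iff A).1 hA x

lemma sxdeg_copositiveCone_eq (k : ℕ) :
    sxdeg (copositiveCone k) = sxdeg (completelyPositiveCone k) := by
  refine le_antisymm ?_ (sxdeg_conicDual_le
    ⟨_, psdCone_subset_copositiveCone k (symOne_mem_psdCone k)⟩)
  rw [← conicDual_completelyPositiveCone]
  exact sxdeg_conicDual_le ⟨_, symOuter_mem_completelyPositiveCone (x := 0) fun _ => le_rfl⟩

/-! ### The lower bound -/

/-- Suppose that finitely many sequences of subspaces are such that for any fewer than `k` indices
and any further index, some sequence has its further member outside the span of the given ones.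
Then the ambient dimension is at least `k`. Along a nonprincipal ultrafilter each sequence either
generically enlarges the current span or generically lies in it, and the second alternative is
permanent; so a sequence that still enlarges its span after `k - 1` generic choices has enlarged it
every time. -/
lemma le_finrank_of_not_le_iSup {V : Type*} [AddCommGroup V] [Module ℝ V]
    [FiniteDimensional ℝ V] {ι : Type*} [Finite ι] (U : ι → ℕ → Submodule ℝ V) {k : ℕ}
    (h : ∀ I : Finset ℕ, I.card < k → ∀ i ∉ I, ∃ j, ¬ U j i ≤ ⨆ l ∈ I, U j l) :
    k ≤ Module.finrank ℝ V := by
  have hnotMem : ∀ I : Finset ℕ, ∀ᶠ i in (Filter.hyperfilter ℕ : Filter ℕ), i ∉ I := fun I =>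
    I.finite_toSet.compl_mem_hyperfilter
  have key : ∀ n, n < k → ∃ I : Finset ℕ, I.card = n ∧ ∀ j,
      n ≤ Module.finrank ℝ (⨆ l ∈ I, U j l : Submodule ℝ V) ∨
        ∀ᶠ i in (Filter.hyperfilter ℕ : Filter ℕ), U j i ≤ ⨆ l ∈ I, U j l := by
    intro n
    induction n with
    | zero => exact fun _ => ⟨∅, rfl, fun j => .inl (Nat.zero_le _)⟩
    | succ n ih =>
      intro hn
      obtain ⟨I, hI, hj⟩ := ih (by omega)
      have hev : ∀ᶠ i in (Filter.hyperfilter ℕ : Filter ℕ), ∀ j, U j i ≤ (⨆ l ∈ I, U j l) →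
          ∀ᶠ i in (Filter.hyperfilter ℕ : Filter ℕ), U j i ≤ ⨆ l ∈ I, U j l := by
        rw [Filter.eventually_all]
        intro j
        by_cases hs : ∀ᶠ i in (Filter.hyperfilter ℕ : Filter ℕ), U j i ≤ ⨆ l ∈ I, U j l
        · exact .of_forall fun _ _ => hs
        · exact (Ultrafilter.eventually_not.2 hs).mono fun i hi hi' => absurd hi' hi
      obtain ⟨i, hi, hiI⟩ := (hev.and (hnotMem I)).exists
      have hle : ∀ j, (⨆ l ∈ I, U j l) ≤ ⨆ l ∈ insert i I, U j l := fun j =>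
        biSup_mono fun l hl => Finset.mem_insert_of_mem hl
      refine ⟨insert i I, by rw [Finset.card_insert_of_notMem hiI, hI], fun j => ?_⟩
      by_cases hs : ∀ᶠ i in (Filter.hyperfilter ℕ : Filter ℕ), U j i ≤ ⨆ l ∈ I, U j l
      · exact .inr (hs.mono fun _ hl => hl.trans (hle j))
      · left
        refine ((hj j).resolve_right hs).trans_lt (Submodule.finrank_lt_finrank_of_lt
          ((hle j).lt_of_ne fun heq => hs (hi j ?_)))
        rw [heq]
        exact le_biSup (U j) (Finset.mem_insert_self i I)
  rcases Nat.eq_zero_or_pos k with rfl | hk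
  · exact Nat.zero_le _
  obtain ⟨I, hI, hj⟩ := key (k - 1) (by omega)
  have hex : ∃ j, ∃ᶠ i in (Filter.hyperfilter ℕ : Filter ℕ), ¬ U j i ≤ ⨆ l ∈ I, U j l := by
    by_contra! hcon
    obtain ⟨i, hi, hiI⟩ := ((Filter.eventually_all.2 hcon).and (hnotMem I)).exists
    obtain ⟨j, hij⟩ := h I (by omega) i hiI
    exact hij (hi j)
  obtain ⟨j, hfr⟩ := hex
  have h1 := (hj j).resolve_right (Filter.not_eventually.2 hfr)
  have h2 : (⨆ l ∈ I, U j l) < ⊤ := by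
    refine lt_top_iff_ne_top.2 fun htop => ?_
    obtain ⟨i, hi⟩ := hfr.exists
    exact hi (htop ▸ le_top)
  have h3 := Submodule.finrank_lt h2.ne
  omega

/-- For fewer than `k` points `i` on the moment curve `(1, i, …, i ^ (k - 1))`, there is a linear
form whose zeros among all its points are exactly the given ones: the coefficient vector of
`∏ (X - i)`. -/
lemma exists_dotProduct_momentCurve_eq_zero_iff {k : ℕ} (I : Finset ℕ) (hI : I.card < k) :
    ∃ c : Fin k → ℝ, ∀ i : ℕ, c ⬝ᵥ (fun l => (i : ℝ) ^ (l : ℕ)) = 0 ↔ i ∈ I := by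
  let p : Polynomial ℝ := ∏ l ∈ I, (Polynomial.X - Polynomial.C (l : ℝ))
  refine ⟨fun l => p.coeff l, fun i => ?_⟩
  have hdeg : p.natDegree < k := by
    rwa [Polynomial.natDegree_finsetProd_X_sub_C_eq_card]
  have h1 : (fun l : Fin k => p.coeff l) ⬝ᵥ (fun l : Fin k => (i : ℝ) ^ (l : ℕ)) =
      p.eval (i : ℝ) := by
    rw [Polynomial.eval_eq_sum_range' hdeg]
    exact Fin.sum_univ_eq_sum_range (fun l => p.coeff l * (i : ℝ) ^ l) k
  rw [h1, Polynomial.eval_prod, Finset.prod_eq_zero_iff]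
  constructor
  · rintro ⟨l, hl, h0⟩
    simp only [Polynomial.eval_sub, Polynomial.eval_X, Polynomial.eval_C, sub_eq_zero,
      Nat.cast_inj] at h0
    exact h0 ▸ hl
  · exact fun hi => ⟨i, hi, by simp⟩

/-- If the copositive cone lifts to blocks of size `r`, the certificates `s i` of the completely
positive matrices `x xᵀ`, with `x` on the moment curve, and the lifts `X I` of the squares of
linear forms vanishing at the points of `I` satisfy `X I j * s i j = 0` for all `j` exactly when
`i ∈ I`. So the column spaces of the `s i j` satisfy the hypothesis of
`le_finrank_of_not_le_iSup`. -/
lemma le_of_hasConeLift_copositiveCone {k r m : ℕ} (hk : 2 ≤ k)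
    (h : HasConeLift (psdConePow r m) (copositiveCone k)) : k ≤ r := by
  obtain ⟨H, π, h1, hH⟩ := exists_lift_through_one
    ⟨_, psdCone_subset_copositiveCone k (symOne_mem_psdCone k)⟩ h
  let x : ℕ → Fin k → ℝ := fun i l => (i : ℝ) ^ (l : ℕ)
  have hx : ∀ i l, 0 ≤ x i l := fun i l => by positivity
  choose s hs t ht hst using fun i => exists_dual_certificate h1
    ((symForm k).flip (symOuter (x i)) ∘ₗ π) fun y hy hyH =>
      symOuter_mem_completelyPositiveCone (hx i) _ (hH ▸ ⟨y, ⟨hy, hyH⟩, rfl⟩)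
  have hX : ∀ I : Finset ℕ, I.card < k → ∃ X ∈ psdConePow r m, X ∈ H ∧
      ∀ i, (∑ j, symInner (s i j) (X j)) + t i = 0 ↔ i ∈ I := by
    intro I hI
    obtain ⟨c, hc⟩ := exists_dotProduct_momentCurve_eq_zero_iff I hI
    have hcop : symOuter c ∈ copositiveCone k :=
      psdCone_subset_copositiveCone k (symOuter_mem_psdCone c)
    rw [hH] at hcop
    obtain ⟨X, ⟨hXK, hXH⟩, hπ⟩ := hcop
    refine ⟨X, hXK, hXH, fun i => ?_⟩
    rw [← hst i X hXH, ← hc]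
    change symInner (π X) (symOuter (x i)) = 0 ↔ _
    have h2 : symInner (symOuter c) (symOuter (x i)) = (c ⬝ᵥ x i) ^ 2 := by
      rw [symInner_symOuter]
      change x i ⬝ᵥ (Matrix.vecMulVec c c *ᵥ x i) = _
      rw [Matrix.vecMulVec_mulVec]
      simp [dotProduct_comm (x i) c, sq]
    rw [hπ, h2, sq_eq_zero_iff]
  -- each certificate is tight at some copositive matrix, as `k ≥ 2`
  have ht0 : ∀ i, t i = 0 := by
    intro i
    obtain ⟨X, hXK, -, hXi⟩ := hX {i} (by rw [Finset.card_singleton]; omega)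
    have h2 := (hXi i).2 (Finset.mem_singleton_self i)
    have h3 : 0 ≤ ∑ j, symInner (s i j) (X j) :=
      Finset.sum_nonneg fun j _ => symInner_nonneg (hs i j) (hXK j)
    linarith [ht i]
  have hfin := le_finrank_of_not_le_iSup (V := Fin r → ℝ) (k := k)
    (fun (j : Fin m) i => LinearMap.range (Matrix.mulVecLin (s i j).1)) (by
      intro I hI i hi
      obtain ⟨X, hXK, -, hXI⟩ := hX I hI
      by_contra! hcon
      refine hi ((hXI i).1 ?_)
      rw [ht0, add_zero]
      refine Finset.sum_eq_zero fun j _ => ?_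
      have h2 : (⨆ l ∈ I, LinearMap.range (Matrix.mulVecLin (s l j).1)) ≤
          LinearMap.ker (Matrix.mulVecLin (X j).1) := by
        refine iSup₂_le fun l hl => ?_
        have h3 := (hXI l).2 hl
        rw [ht0, add_zero, Finset.sum_eq_zero_iff_of_nonneg
          fun j _ => symInner_nonneg (hs l j) (hXK j)] at h3
        have h4 := h3 j (Finset.mem_univ j)
        rw [symInner_comm] at h4
        have h5 := mul_eq_zero_of_symInner_eq_zero (hXK j) (hs l j) h4
        rw [LinearMap.range_le_ker_iff, ← Matrix.mulVecLin_mul, h5, Matrix.mulVecLin_zero]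
      have h3 := LinearMap.range_le_ker_iff.1 ((hcon j).trans h2)
      rw [← Matrix.mulVecLin_mul] at h3
      have h4 : (X j).1 * (s i j).1 = 0 := by
        refine Matrix.toLin'.injective ?_
        rw [map_zero]
        exact h3
      rw [symInner_comm, symInner_eq_trace, h4, Matrix.trace_zero])
  simpa using hfin

lemma le_sxdeg_copositiveCone (k : ℕ) : (k : ℕ∞) ≤ sxdeg (copositiveCone k) := by
  refine le_sInf ?_
  rintro d ⟨r, rfl, hr, m, -, h⟩
  rw [Nat.cast_le]
  rcases lt_or_ge k 2 with hk | hk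
  · omega
  · exact le_of_hasConeLift_copositiveCone hk h

/-! ### Doubly nonnegative matrices of size at most four -/

/-- The cone of doubly nonnegative matrices: positive semidefinite with nonnegative entries. -/
def doublyNonnegativeCone (k : ℕ) : Set (SymMat k) :=
  {B | B ∈ psdCone k ∧ ∀ i j, 0 ≤ B.1 i j}

lemma symMat_apply_comm {k : ℕ} (B : SymMat k) (i j : Fin k) : B.1 i j = B.1 j i :=
  (B.2.apply i j).symm

/-- The range of a symmetric matrix is the orthogonal complement of its kernel. -/
lemma exists_mulVec_eq_of_orthogonal {k : ℕ} (B : SymMat k) {w : Fin k → ℝ}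
    (hw : ∀ u, B.1 *ᵥ u = 0 → u ⬝ᵥ w = 0) : ∃ z, B.1 *ᵥ z = w := by
  obtain ⟨G, -, hcomm, hBG⟩ := exists_pseudoinverse B.2
  refine ⟨G *ᵥ w, ?_⟩
  set y := w - B.1 *ᵥ (G *ᵥ w)
  have h1 : B.1 *ᵥ y = 0 := by
    rw [Matrix.mulVec_sub, Matrix.mulVec_mulVec, Matrix.mulVec_mulVec, mul_assoc, hcomm,
      ← mul_assoc, hBG, sub_self]
  have h2 : y ⬝ᵥ (B.1 *ᵥ (G *ᵥ w)) = 0 := by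
    rw [Matrix.dotProduct_mulVec, ← Matrix.mulVec_transpose, show B.1ᵀ = B.1 from B.2, h1,
      zero_dotProduct]
  have h3 : y ⬝ᵥ y = 0 := by
    conv_lhs => rw [show y = w - B.1 *ᵥ (G *ᵥ w) from rfl, dotProduct_sub]
    rw [hw _ h1, h2, sub_zero]
  exact (sub_eq_zero.1 (dotProduct_self_eq_zero.1 h3)).symm

lemma apply_eq_zero_of_diag_eq_zero {k : ℕ} {B : SymMat k} (hB : B ∈ psdCone k) {i : Fin k}
    (hi : B.1 i i = 0) (j : Fin k) : B.1 i j = 0 := by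
  have h := (Matrix.PosSemidef.dotProduct_mulVec_zero_iff hB (Pi.single i 1)).1 (by simpa)
  rw [symMat_apply_comm]
  simpa using congrFun h j

lemma mulVec_apply_eq_zero_of_diag_eq_zero {k : ℕ} {B : SymMat k} (hB : B ∈ psdCone k)
    {i : Fin k} (hi : B.1 i i = 0) (z : Fin k → ℝ) : (B.1 *ᵥ z) i = 0 := by
  simp [Matrix.mulVec, dotProduct, apply_eq_zero_of_diag_eq_zero hB hi]

/-- A nonzero vector in the range of `B` which has no two nonzero entries at a zero of `B`, when
the kernel of `B` is at most a line spanned by `u`. If `u i = 0`, the unit vector `e i` works;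
otherwise `u j • e i - u i • e j` works for any nonzero off-diagonal entry `(i, j)`. -/
lemma exists_range_vector_of_ker_le_line {k : ℕ} {B : SymMat k} (hB : B ∈ psdCone k) (h0 : B ≠ 0)
    {u : Fin k → ℝ} (hu : B.1 *ᵥ u = 0) (hker : ∀ v, B.1 *ᵥ v = 0 → ∃ c : ℝ, c • u = v) :
    ∃ z, B.1 *ᵥ z ≠ 0 ∧ ∀ i j, B.1 i j = 0 → (B.1 *ᵥ z) i * (B.1 *ᵥ z) j = 0 := by
  have horth : ∀ w : Fin k → ℝ, u ⬝ᵥ w = 0 → ∃ z, B.1 *ᵥ z = w := fun w hw =>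
    exists_mulVec_eq_of_orthogonal B fun v hv => by
      obtain ⟨c, rfl⟩ := hker v hv
      rw [smul_dotProduct, hw, smul_zero]
  by_cases hz : ∃ i, u i = 0
  · obtain ⟨i, hi⟩ := hz
    obtain ⟨z, hz⟩ := horth (Pi.single i 1) (by simpa using hi)
    refine ⟨z, hz ▸ by simp, fun p q hpq => ?_⟩
    by_cases hpi : p = i
    · by_cases hqi : q = i
      · rw [hpi, hqi] at hpq
        rw [hpi, mulVec_apply_eq_zero_of_diag_eq_zero hB hpq, zero_mul]
      · simp [hz, hqi]
    · simp [hz, hpi]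
  · push Not at hz
    obtain ⟨i, j, hij, hBij⟩ : ∃ i j, i ≠ j ∧ B.1 i j ≠ 0 := by
      by_contra! hcon
      refine h0 (Subtype.ext (Matrix.ext fun i j => ?_))
      by_cases hij : i = j
      · subst hij
        have h1 : ∑ l, B.1 i l * u l = 0 := congrFun hu i
        rw [Finset.sum_eq_single i (fun l _ hl => by rw [hcon i l (Ne.symm hl), zero_mul])
          (by simp)] at h1
        exact (mul_eq_zero.1 h1).resolve_right (hz i)
      · exact hcon i j hij
    obtain ⟨z, hw⟩ := horth (Pi.single i (u j) - Pi.single j (u i)) (by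
      simp [dotProduct_sub, mul_comm])
    refine ⟨z, fun h => hz j ?_, fun p q hpq => ?_⟩
    · have := congrFun (hw.symm.trans h) i
      simpa [hij] using this
    · by_cases hpq' : p = q
      · subst hpq'
        rw [mulVec_apply_eq_zero_of_diag_eq_zero hB hpq, zero_mul]
      · rw [hw]
        by_cases hpi : p = i
        · subst hpi
          have hqj : q ≠ j := fun h => hBij (h ▸ hpq)
          simp [Ne.symm hpq', hqj]
        · by_cases hpj : p = j
          · subst hpj
            have hqi : q ≠ i := fun h => hBij (by rw [symMat_apply_comm, ← h, hpq])
            simp [Ne.symm hpq', hqi]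
          · simp [hpi, hpj]

/-- The same for a doubly nonnegative matrix of rank at most two. As a Gram matrix of vectors in a
plane with nonnegative inner products, if two of these are nonzero and orthogonal then they span
the boundary rays of a quadrant that contains all of them, and any orthogonal pair lies on these
rays; the column of `B` of either of them works. Otherwise any nonzero column works. -/
lemma exists_range_vector_of_rank_le_two {k : ℕ} {B : SymMat k}
    (hB : B ∈ doublyNonnegativeCone k) (h0 : B ≠ 0)
    (hrank : Module.finrank ℝ (LinearMap.range (Matrix.mulVecLin B.1)) ≤ 2) :
    ∃ z, B.1 *ᵥ z ≠ 0 ∧ ∀ i j, B.1 i j = 0 → (B.1 *ᵥ z) i * (B.1 *ᵥ z) j = 0 := by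
  obtain ⟨i, hi, hind⟩ : ∃ i, B.1 i i ≠ 0 ∧
      ∀ p q, B.1 p q = 0 → B.1 p i * B.1 q i = 0 := by
    by_cases hex : ∃ i j, B.1 i j = 0 ∧ B.1 i i ≠ 0 ∧ B.1 j j ≠ 0
    · obtain ⟨i, j, hij, hi, hj⟩ := hex
      refine ⟨i, hi, fun p q hpq => ?_⟩
      -- the columns `i`, `j`, `p` are linearly dependent
      let c : Fin 3 → LinearMap.range (Matrix.mulVecLin B.1) := fun l =>
        ⟨B.1 *ᵥ Pi.single (![i, j, p] l) 1, LinearMap.mem_range_self _ _⟩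
      have hdep : ¬ LinearIndependent ℝ c := fun hli => by
        have := hli.fintype_card_le_finrank
        rw [Fintype.card_fin] at this
        omega
      rw [Fintype.not_linearIndependent_iff] at hdep
      obtain ⟨g, hg, hne⟩ := hdep
      have hcol : ∀ l, g 0 * B.1 l i + g 1 * B.1 l j + g 2 * B.1 l p = 0 := by
        intro l
        have h1 := congrFun (congrArg Subtype.val hg) l
        simpa [c, Fin.sum_univ_three] using h1
      have hji : B.1 j i = 0 := by rw [symMat_apply_comm, hij]
      have hci := hcol i
      have hcj := hcol j
      have hcq := hcol q
      rw [hij, mul_zero, add_zero] at hci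
      rw [hji, mul_zero, zero_add] at hcj
      rw [symMat_apply_comm B q p, hpq, mul_zero, add_zero] at hcq
      have hg2 : g 2 ≠ 0 := by
        intro h2
        rw [h2, zero_mul, add_zero] at hci hcj
        obtain ⟨l, hl⟩ := hne
        have h3 := (mul_eq_zero.1 hci).resolve_right hi
        have h4 := (mul_eq_zero.1 hcj).resolve_right hj
        fin_cases l
        · exact hl h3
        · exact hl h4
        · exact hl h2
      have hip := hB.2 i p
      have hjp := hB.2 j p
      have hqi := hB.2 q i
      have hqj := hB.2 q j
      have hii : 0 < B.1 i i := lt_of_le_of_ne (hB.2 i i) (Ne.symm hi)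
      have hjj : 0 < B.1 j j := lt_of_le_of_ne (hB.2 j j) (Ne.symm hj)
      have e1 : g 0 = -(g 2) * (B.1 i p / B.1 i i) := by field_simp; linarith
      have e2 : g 1 = -(g 2) * (B.1 j p / B.1 j j) := by field_simp; linarith
      have e3 : B.1 i p / B.1 i i * B.1 q i + B.1 j p / B.1 j j * B.1 q j = 0 := by
        refine (mul_eq_zero.1 ?_).resolve_left (neg_ne_zero.2 hg2)
        rw [e1, e2] at hcq
        linarith
      have n1 : 0 ≤ B.1 i p / B.1 i i * B.1 q i := by positivity
      have n2 : 0 ≤ B.1 j p / B.1 j j * B.1 q j := by positivity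
      have e4 : B.1 i p / B.1 i i * B.1 q i = 0 := by linarith
      rw [symMat_apply_comm B p i]
      rcases mul_eq_zero.1 e4 with h | h
      · rw [(div_eq_zero_iff.1 h).resolve_right hi, zero_mul]
      · rw [h, mul_zero]
    · push Not at hex
      obtain ⟨i, hi⟩ : ∃ i, B.1 i i ≠ 0 := by
        by_contra! hcon
        exact h0 (Subtype.ext (Matrix.ext fun i j =>
          apply_eq_zero_of_diag_eq_zero hB.1 (hcon i) j))
      refine ⟨i, hi, fun p q hpq => ?_⟩
      by_cases hp : B.1 p p = 0
      · rw [apply_eq_zero_of_diag_eq_zero hB.1 hp, zero_mul]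
      · rw [apply_eq_zero_of_diag_eq_zero hB.1 (hex p q hpq hp) i, mul_zero]
  refine ⟨Pi.single i 1, fun h => hi ?_, fun p q hpq => ?_⟩
  · simpa using congrFun h i
  · simpa using hind p q hpq

/-- In size at most four, either the kernel is at most a line or the rank is at most two. -/
lemma exists_range_vector {k : ℕ} (hk : k ≤ 4) {B : SymMat k}
    (hB : B ∈ doublyNonnegativeCone k) (h0 : B ≠ 0) :
    ∃ z, B.1 *ᵥ z ≠ 0 ∧ ∀ i j, B.1 i j = 0 → (B.1 *ᵥ z) i * (B.1 *ᵥ z) j = 0 := by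
  by_cases h1 : Module.finrank ℝ (LinearMap.ker (Matrix.mulVecLin B.1)) ≤ 1
  · obtain ⟨u, hu⟩ := finrank_le_one_iff.1 h1
    refine exists_range_vector_of_ker_le_line hB.1 h0 u.2 fun v hv => ?_
    obtain ⟨c, hc⟩ := hu ⟨v, hv⟩
    exact ⟨c, congrArg Subtype.val hc⟩
  · refine exists_range_vector_of_rank_le_two hB h0 ?_
    have h2 := LinearMap.finrank_range_add_finrank_ker (Matrix.mulVecLin B.1)
    rw [Module.finrank_fin_fun] at h2
    omega

/-- Subtracting from `B` a small multiple of `w wᵀ`, with `w` in the range of `B`, preserves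
positive semidefiniteness, by the Cauchy-Schwarz inequality for the form `B`. -/
lemma sub_smul_symOuter_mem_psdCone {k : ℕ} {B : SymMat k} (hB : B ∈ psdCone k) (z : Fin k → ℝ)
    {c ε : ℝ} (hε : 0 ≤ ε) (hc : ε * (z ⬝ᵥ (B.1 *ᵥ z)) ≤ c) :
    c • B - ε • symOuter (B.1 *ᵥ z) ∈ psdCone k := by
  rw [mem_psdCone_iff]
  intro v
  have hcs : (v ⬝ᵥ (B.1 *ᵥ z)) ^ 2 ≤ (v ⬝ᵥ (B.1 *ᵥ v)) * (z ⬝ᵥ (B.1 *ᵥ z)) := by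
    have h1 := LinearMap.BilinForm.apply_mul_apply_le_of_forall_zero_le (Matrix.toBilin' B.1)
      (fun x => by rw [Matrix.toBilin'_apply']; exact (mem_psdCone_iff B).1 hB x) v z
    simp only [Matrix.toBilin'_apply'] at h1
    have h2 : z ⬝ᵥ (B.1 *ᵥ v) = v ⬝ᵥ (B.1 *ᵥ z) := by
      rw [Matrix.dotProduct_mulVec, ← Matrix.mulVec_transpose, show B.1ᵀ = B.1 from B.2,
        dotProduct_comm]
    rwa [h2, ← sq] at h1
  have h3 : v ⬝ᵥ ((c • B - ε • symOuter (B.1 *ᵥ z)).1 *ᵥ v) =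
      c * (v ⬝ᵥ (B.1 *ᵥ v)) - ε * (v ⬝ᵥ (B.1 *ᵥ z)) ^ 2 := by
    change v ⬝ᵥ ((c • B.1 - ε • Matrix.vecMulVec _ _) *ᵥ v) = _
    rw [Matrix.sub_mulVec, Matrix.smul_mulVec, Matrix.smul_mulVec, Matrix.vecMulVec_mulVec]
    simp [dotProduct_comm _ v, sq]
  rw [h3]
  nlinarith [(mem_psdCone_iff B).1 hB v]

/-- The trace one slice of the doubly nonnegative cone. -/
def doublyNonnegativeBase (k : ℕ) : Set (SymMat k) :=
  {B | B ∈ doublyNonnegativeCone k ∧ B.1.trace = 1}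

lemma convex_doublyNonnegativeBase (k : ℕ) : Convex ℝ (doublyNonnegativeBase k) := by
  intro A hA B hB a b ha hb hab
  refine ⟨⟨(hA.1.1.smul ha).add (hB.1.1.smul hb), fun i j => ?_⟩, ?_⟩
  · exact add_nonneg (mul_nonneg ha (hA.1.2 i j)) (mul_nonneg hb (hB.1.2 i j))
  · change (a • A.1 + b • B.1).trace = 1
    rw [Matrix.trace_add, Matrix.trace_smul, Matrix.trace_smul, hA.2, hB.2]
    simpa using hab

/-- An extreme point of the trace one slice has rank one if its range contains a vector `w` with
no two nonzero entries at a zero of `B`: the matrix can be moved in both directions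
`± (w wᵀ - ‖w‖² B)` within the slice. -/
lemma symOuter_eq_smul_of_mem_extremePoints {k : ℕ} {B : SymMat k}
    (hB : B ∈ (doublyNonnegativeBase k).extremePoints ℝ) {z : Fin k → ℝ}
    (hz : ∀ i j, B.1 i j = 0 → (B.1 *ᵥ z) i * (B.1 *ᵥ z) j = 0) :
    symOuter (B.1 *ᵥ z) = ((B.1 *ᵥ z) ⬝ᵥ (B.1 *ᵥ z)) • B := by
  obtain ⟨⟨⟨hBpsd, hBnn⟩, hBtr⟩, hext⟩ := hB
  set w := B.1 *ᵥ z
  set N := w ⬝ᵥ w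
  have hN : 0 ≤ N := Finset.sum_nonneg fun i _ => mul_self_nonneg _
  have htr : (symOuter w).1.trace = N := Matrix.trace_vecMulVec w w
  have hentry : ∀ i j, ∀ᶠ ε : ℝ in nhdsWithin 0 (Set.Ioi 0),
      0 ≤ (1 - ε * N) * B.1 i j + ε * (w i * w j) ∧
      0 ≤ (1 + ε * N) * B.1 i j - ε * (w i * w j) := by
    intro i j
    rcases (hBnn i j).eq_or_lt with h | h
    · refine .of_forall fun ε => ?_
      rw [← h, hz i j h.symm]
      simp
    · refine nhdsWithin_le_nhds (Filter.Eventually.and ?_ ?_)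
      · have hc : Continuous fun ε : ℝ => (1 - ε * N) * B.1 i j + ε * (w i * w j) := by fun_prop
        exact (hc.tendsto 0).eventually (Ici_mem_nhds (by simpa using h))
      · have hc : Continuous fun ε : ℝ => (1 + ε * N) * B.1 i j - ε * (w i * w j) := by fun_prop
        exact (hc.tendsto 0).eventually (Ici_mem_nhds (by simpa using h))
  have hsmall : ∀ᶠ ε : ℝ in nhdsWithin 0 (Set.Ioi 0),
      ε * N ≤ 1 ∧ ε * (z ⬝ᵥ (B.1 *ᵥ z)) ≤ 1 := by
    refine nhdsWithin_le_nhds (Filter.Eventually.and ?_ ?_)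
    · have hc : Continuous fun ε : ℝ => ε * N := by fun_prop
      exact (hc.tendsto 0).eventually (Iic_mem_nhds (by simp))
    · have hc : Continuous fun ε : ℝ => ε * (z ⬝ᵥ (B.1 *ᵥ z)) := by fun_prop
      exact (hc.tendsto 0).eventually (Iic_mem_nhds (by simp))
  obtain ⟨ε, ⟨hent, hε1, hε2⟩, hε⟩ := ((Filter.eventually_all.2 fun i =>
    Filter.eventually_all.2 (hentry i)).and hsmall |>.and self_mem_nhdsWithin).exists
  replace hε : 0 < ε := hε
  have hεN : 0 ≤ ε * N := mul_nonneg hε.le hN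
  have hplus : (1 - ε * N) • B + ε • symOuter w ∈ doublyNonnegativeBase k := by
    refine ⟨⟨(hBpsd.smul (by linarith)).add ((symOuter_mem_psdCone w).smul hε.le),
      fun i j => (hent i j).1⟩, ?_⟩
    change ((1 - ε * N) • B.1 + ε • (symOuter w).1).trace = 1
    rw [Matrix.trace_add, Matrix.trace_smul, Matrix.trace_smul, hBtr, htr]
    simp
  have hminus : (1 + ε * N) • B - ε • symOuter w ∈ doublyNonnegativeBase k := by
    refine ⟨⟨sub_smul_symOuter_mem_psdCone hBpsd z hε.le (by linarith),
      fun i j => (hent i j).2⟩, ?_⟩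
    change ((1 + ε * N) • B.1 - ε • (symOuter w).1).trace = 1
    rw [Matrix.trace_sub, Matrix.trace_smul, Matrix.trace_smul, hBtr, htr]
    simp
  have heq := hext hplus hminus ⟨1 / 2, 1 / 2, by norm_num, by norm_num, by norm_num, by module⟩
  have h1 : ε • (symOuter w - N • B) = 0 := by
    rw [← sub_eq_zero.2 heq]
    module
  exact sub_eq_zero.1 ((smul_eq_zero.1 h1).resolve_left hε.ne')

/-- An extreme point is a multiple of `w wᵀ`, and its entries being nonnegative, `w` can be replaced
by its entrywise absolute value. -/
lemma symInner_nonneg_of_mem_extremePoints {k : ℕ} (hk : k ≤ 4) {A B : SymMat k}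
    (hA : A ∈ copositiveCone k) (hB : B ∈ (doublyNonnegativeBase k).extremePoints ℝ) :
    0 ≤ symInner A B := by
  have h0 : B ≠ 0 := by
    rintro rfl
    have h := hB.1.2
    simp at h
  obtain ⟨z, hz0, hz⟩ := exists_range_vector hk hB.1.1 h0
  have heq := symOuter_eq_smul_of_mem_extremePoints hB hz
  set w := B.1 *ᵥ z
  have hN : 0 < w ⬝ᵥ w := lt_of_le_of_ne (Finset.sum_nonneg fun i _ => mul_self_nonneg _)
    fun h => hz0 (dotProduct_self_eq_zero.1 h.symm)
  have habs : symOuter w = symOuter fun i => |w i| := by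
    refine Subtype.ext (Matrix.ext fun i j => ?_)
    rw [symOuter_apply, symOuter_apply, ← abs_mul, abs_of_nonneg]
    have h1 := congrArg (fun X : SymMat k => X.1 i j) heq
    change w i * w j = (w ⬝ᵥ w) * B.1 i j at h1
    rw [h1]
    exact mul_nonneg hN.le (hB.1.1.2 i j)
  have h1 : (w ⬝ᵥ w) * symInner A B = symInner A (symOuter w) := by
    rw [heq, ← symForm_apply, ← symForm_apply, map_smul, smul_eq_mul]
  refine nonneg_of_mul_nonneg_right (h1 ▸ ?_) hN
  rw [habs, symInner_symOuter]
  exact hA _ fun i => abs_nonneg _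

section Compactness

attribute [local instance] Matrix.normedAddCommGroup Matrix.normedSpace

lemma isCompact_doublyNonnegativeBase (k : ℕ) : IsCompact (doublyNonnegativeBase k) := by
  have hcont : ∀ g : SymMat k →ₗ[ℝ] ℝ, Continuous g := fun g =>
    LinearMap.continuous_of_finiteDimensional g
  have hclosed : IsClosed (doublyNonnegativeBase k) := by
    have h1 : doublyNonnegativeBase k =
        ((⋂ x : Fin k → ℝ, {B : SymMat k | 0 ≤ symForm k (symOuter x) B}) ∩
          ⋂ i, ⋂ j, {B : SymMat k | 0 ≤ B.1 i j}) ∩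
        {B : SymMat k | symForm k (symOne k) B = 1} := by
      ext B
      have h2 : ∀ x, symForm k (symOuter x) B = x ⬝ᵥ (B.1 *ᵥ x) := fun x => by
        rw [symForm_apply, symInner_comm, symInner_symOuter]
      have h3 : symForm k (symOne k) B = B.1.trace := by
        rw [symForm_apply, symInner_eq_trace, symOne, one_mul]
      simp only [doublyNonnegativeBase, doublyNonnegativeCone, mem_psdCone_iff,
        Set.mem_inter_iff, Set.mem_ofPred_eq, Set.mem_iInter, h2, h3]
    rw [h1]
    refine ((isClosed_iInter fun x => ?_).inter (isClosed_iInter fun i =>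
      isClosed_iInter fun j => ?_)).inter ?_
    · exact isClosed_le continuous_const (hcont _)
    · exact isClosed_le continuous_const (hcont
        (LinearMap.proj j ∘ₗ LinearMap.proj i ∘ₗ (SymMat k).subtype))
    · exact isClosed_eq (hcont _) continuous_const
  refine Metric.isCompact_of_isClosed_isBounded hclosed
    ((Metric.isBounded_closedBall (x := (0 : SymMat k)) (r := 1)).subset fun B hB => ?_)
  rw [mem_closedBall_zero_iff]
  change ‖B.1‖ ≤ 1
  have hdiag : ∀ i, B.1 i i ≤ 1 := fun i => by
    rw [← hB.2]
    exact Finset.single_le_sum (f := fun i => B.1 i i) (fun i _ => hB.1.2 i i)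
      (Finset.mem_univ i)
  rw [Matrix.norm_le_iff zero_le_one]
  intro i j
  rw [Real.norm_of_nonneg (hB.1.2 i j)]
  have h1 := (mem_psdCone_iff B).1 hB.1.1 (Pi.single i 1 - Pi.single j 1)
  have h2 : (Pi.single i 1 - Pi.single j 1) ⬝ᵥ (B.1 *ᵥ (Pi.single i 1 - Pi.single j 1)) =
      B.1 i i + B.1 j j - 2 * B.1 i j := by
    simp [Matrix.mulVec_sub, sub_dotProduct, symMat_apply_comm B j i]
    ring
  linarith [hdiag i, hdiag j]

/-- By the Krein-Milman theorem, it suffices to consider extreme points. -/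
lemma symInner_nonneg_of_mem_doublyNonnegativeBase {k : ℕ} (hk : k ≤ 4) {A B : SymMat k}
    (hA : A ∈ copositiveCone k) (hB : B ∈ doublyNonnegativeBase k) : 0 ≤ symInner A B := by
  have : LocallyConvexSpace ℝ (SymMat k) := NormedSpace.toLocallyConvexSpace
  rw [← closure_convexHull_extremePoints (isCompact_doublyNonnegativeBase k)
    (convex_doublyNonnegativeBase k)] at hB
  have hclosed : IsClosed {B : SymMat k | 0 ≤ symForm k A B} :=
    isClosed_le continuous_const (LinearMap.continuous_of_finiteDimensional _)
  exact closure_minimal (convexHull_min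
    (fun C hC => symInner_nonneg_of_mem_extremePoints hk hA hC)
    (convex_halfSpace_ge (symForm k A).isLinear 0)) hclosed hB

end Compactness

/-- In size at most four, completely positive is the same as doubly nonnegative. -/
lemma completelyPositiveCone_eq {k : ℕ} (hk : k ≤ 4) :
    completelyPositiveCone k = doublyNonnegativeCone k := by
  ext B
  constructor
  · intro hB
    refine ⟨(mem_psdCone_iff B).2 fun x => ?_, fun i j => ?_⟩
    · rw [← symInner_symOuter, symInner_comm]
      exact hB _ (psdCone_subset_copositiveCone k (symOuter_mem_psdCone x))
    · -- pair `B` with the copositive matrix `e i (e j)ᵀ + e j (e i)ᵀ`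
      let E : SymMat k := symOuter (Pi.single i 1 + Pi.single j 1) -
        symOuter (Pi.single i 1) - symOuter (Pi.single j 1)
      have hE : ∀ v, v ⬝ᵥ (E.1 *ᵥ v) = 2 * (v i * v j) := by
        intro v
        rw [← symInner_symOuter, symInner_comm, ← symForm_apply, map_sub, map_sub]
        simp only [symForm_apply, symInner_symOuter]
        have h1 : ∀ x, x ⬝ᵥ ((symOuter v).1 *ᵥ x) = (x ⬝ᵥ v) ^ 2 := fun x => by
          change x ⬝ᵥ (Matrix.vecMulVec v v *ᵥ x) = _
          rw [Matrix.vecMulVec_mulVec]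
          simp [dotProduct_comm v x, sq]
        rw [h1, h1, h1]
        simp [add_dotProduct]
        ring
      have h1 := hB E fun x hx => by
        rw [hE]
        have := hx i
        have := hx j
        positivity
      rw [symInner_comm, ← symForm_apply, map_sub, map_sub] at h1
      simp only [symForm_apply, symInner_symOuter] at h1
      simp [Matrix.mulVec_add, add_dotProduct, symMat_apply_comm B j i] at h1
      linarith
  · intro hB A hA
    by_cases htr : B.1.trace = 0
    · have h0 : B = 0 := Subtype.ext (hB.1.trace_eq_zero_iff.1 htr)
      rw [h0, ← symForm_apply, map_zero]
    · have hpos : 0 < B.1.trace := lt_of_le_of_ne hB.1.trace_nonneg (Ne.symm htr)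
      have h1 : (B.1.trace)⁻¹ • B ∈ doublyNonnegativeBase k := by
        refine ⟨⟨hB.1.smul (inv_nonneg.2 hpos.le), fun i j =>
          mul_nonneg (inv_nonneg.2 hpos.le) (hB.2 i j)⟩, ?_⟩
        change ((B.1.trace)⁻¹ • B.1).trace = 1
        rw [Matrix.trace_smul, smul_eq_mul, inv_mul_cancel₀ htr]
      have h2 := symInner_nonneg_of_mem_doublyNonnegativeBase hk hA h1
      rw [← symForm_apply, map_smul, smul_eq_mul] at h2
      exact nonneg_of_mul_nonneg_right h2 (inv_pos.2 hpos)

/-! ### Semidefinite extension degree -/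

lemma sxdeg_doublyNonnegativeCone_le {k : ℕ} (hk : 1 ≤ k) :
    sxdeg (doublyNonnegativeCone k) ≤ k := by
  have : NeZero k := ⟨by omega⟩
  let W : Submodule ℝ ((Fin 1 → SymMat k) × (Fin k × Fin k → ℝ) × SymMat k) :=
    { carrier := {p | p.1 0 = p.2.2 ∧ ∀ i j, p.2.1 (i, j) = p.2.2.1 i j}
      add_mem' := fun {p q} hp hq => ⟨by simp [hp.1, hq.1], fun i j => by simp [hp.2, hq.2]⟩
      zero_mem' := by simp
      smul_mem' := fun c p hp => ⟨by simp [hp.1], fun i j => by simp [hp.2]⟩ }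
  obtain ⟨n, hn, h⟩ := hasConeLift_of_extendedFormulation hk W
  refine sInf_le ⟨k, rfl, hk, n, hn, ?_⟩
  convert h using 1
  ext B
  constructor
  · intro hB
    exact ⟨fun _ => B, fun _ => hB.1, fun p => B.1 p.1 p.2, fun p => hB.2 _ _, rfl,
      fun _ _ => rfl⟩
  · rintro ⟨s, hs, t, ht, h1, h2⟩
    dsimp only at h1 h2
    exact ⟨h1 ▸ hs 0, fun i j => h2 i j ▸ ht _⟩

theorem corollary2p14 (k : ℕ) (hk : 1 ≤ k) :
    sxdeg (copositiveCone k) = sxdeg (completelyPositiveCone k) ∧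
    (k : ℕ∞) ≤ sxdeg (copositiveCone k) ∧
    (k : ℕ∞) ≤ sxdeg (completelyPositiveCone k) ∧
    (k ≤ 4 → sxdeg (copositiveCone k) = (k : ℕ∞) ∧
      sxdeg (completelyPositiveCone k) = (k : ℕ∞)) := by
  have h1 := sxdeg_copositiveCone_eq k
  have h2 := le_sxdeg_copositiveCone k
  refine ⟨h1, h2, h1 ▸ h2, fun hk4 => ?_⟩
  have h3 : sxdeg (completelyPositiveCone k) = k :=
    le_antisymm (completelyPositiveCone_eq hk4 ▸ sxdeg_doublyNonnegativeCone_le hk) (h1 ▸ h2)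
  exact ⟨h1.trans h3, h3⟩
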